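/- Let $E$ and $F$ be complex Banach spaces, $(\Omega,\mathfrak M,\mu)$ a measure space, $1\le p<\infty$ and $\frac1p+\frac1{p'}=1$. Here $\ell_{p'}(F)$ is the space of sequences $(y_n)$ in $F$ with $\|(y_n)\|_{p'}=\big(\sum_n\|y_n\|^{p'}\big)^{1/p'}<\infty$ (the supremum norm if $p'=\infty$), and $\ell^w_p(E)$ is the space of sequences $(x_n)$ in $E$ with $(\varphi(x_n))_n\in\ell_p$ for every $\varphi\in E^*$, with norm $\|(x_n)\|_{p,w}=\sup_{\|\varphi\|\le1}\big(\sum_n|\varphi(x_n)|^p\big)^{1/p}$; the same notation is used for finite families. Let $\Pi_p(E,F^*)$ be the space of $p$-summing operators, i.e. of bounded $T\colon E\to F^*$ for which there is $C>0$ with $\|(Tx_k)_{k=1}^n\|_p\le C\,\|(x_k)_{k=1}^n\|_{p,w}$ for all $n$ and all $x_1,\dots,x_n\in E$. Let $E\widehat\otimes_{d_{p'}}F$ be the completion of $E\otimes F$ under the Chevet–Saphar norm $$d_{p'}(z)=\inf\Big\{\|(x_j)_{j=1}^n\|_{p,w}\,\|(y_j)_{j=1}^n\|_{p'} : z=\sum_{j=1}^n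 x_j\otimes y_j\Big\}.$$ Its dual is identified with $\Pi_p(E,F^*)$; the pairing $\langle T,z\rangle$ is the continuous extension of $\big\langle T,\sum_j x_j\otimes y_j\big\rangle=\sum_j\langle Tx_j,y_j\rangle$. Let $\mathcal A\colon\Omega\to\mathcal B(E,F^*)$ be weakly$^*$ measurable (that is, $t\mapsto\langle\mathcal A_tx,y\rangle$ is measurable for all $x\in E$, $y\in F$), let $\mathcal A_t\in\Pi_p(E,F^*)$ for almost every $t\in\Omega$, and suppose that $$\sum_{n=1}^\infty|\langle\mathcal A_tx_n,y_n\rangle|\in L_1(\Omega,\mathfrak M,\mu)\quad\text{for every }(x_n)\in\ell^w_p(E)\text{ and }(y_n)\in\ell_{p'}(F).$$ Then $\mathcal A$ is Gel'fand integrable as a $\Pi_p(E,F^*)$-valued function: it agrees almost everywhere with a function $f\colon\Omega\to\Pi_p(E,F^*)$ such that $t\mapsto\langle f(t),z\rangle$ is measurable and $\mu$-integrable for every $z\in E\widehat\otimes_{d_{p'}}F$. Moreover, its Gel'fand norm satisfies $$\|\mathcal A\|_{\mathbb G}=\sup_{\|z\|\le1}\int_\Omega|\langle f(t),z\rangle|\,d\mu(t)\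 \le\ \sup_{\substack{\|(x_n)\|_{p,w}\le1\\ \|(y_n)\|_{p'}\le1}}\int_\Omega\sum_{n=1}^\infty|\langle\mathcal A_tx_n,y_n\rangle|\,d\mu(t)\ <\ \infty,$$ where the first supremum is over $z\in E\widehat\otimes_{d_{p'}}F$. -/

import Mathlib

open MeasureTheory
open scoped ENNReal TensorProduct

noncomputable section

namespace GelfandSumming

section SequenceNorms

variable {ι κ : Type*} {G : Type*} [NormedAddCommGroup G]

/-- The `ℓ_r(G)`-norm, `0 < r ≤ ∞`, of a finite or infinite family `x` in `G`, with value `∞` if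
`x` is not in `ℓ_r(G)`. -/
def seqNorm (r : ℝ≥0∞) (x : ι → G) : ℝ≥0∞ :=
  if r = ∞ then ⨆ i, ‖x i‖ₑ else (∑' i, ‖x i‖ₑ ^ r.toReal) ^ (r⁻¹).toReal

/-- The weak `ℓ_r`-norm `sup_{‖φ‖ ≤ 1} ‖(φ(x_i))_i‖_r` (`φ` in the dual of `G`) of a family `x`. -/
def weakSeqNorm [NormedSpace ℂ G] (r : ℝ≥0∞) (x : ι → G) : ℝ≥0∞ :=
  ⨆ (φ : StrongDual ℂ G) (_ : ‖φ‖ ≤ 1), seqNorm r (fun i => φ (x i))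

/-- `x ∈ ℓ_r(G)`. -/
def MemEll (r : ℝ≥0∞) (x : ℕ → G) : Prop :=
  seqNorm r x < ∞

/-- `x ∈ ℓ_r^w(G)`: the scalar sequence `(φ(x_n))_n` lies in `ℓ_r` for every functional `φ`. -/
def MemWeakEll [NormedSpace ℂ G] (r : ℝ≥0∞) (x : ℕ → G) : Prop :=
  ∀ φ : StrongDual ℂ G, MemEll r (fun n => φ (x n))

/-- `MemEll` agrees with Mathlib's `Memℓp`. -/
theorem memEll_iff {r : ℝ≥0∞} (hr : r ≠ 0) (x : ℕ → G) : MemEll r x ↔ Memℓp x r := by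
  unfold MemEll seqNorm
  split_ifs with h
  · subst h
    rw [memℓp_infty_iff]
    simp only [enorm_eq_nnnorm]
    rw [ENNReal.iSup_coe_lt_top, ← NNReal.bddAbove_coe, ← Set.range_comp]
    rfl
  · have hpos := ENNReal.toReal_pos hr h
    have h1 : 0 < (r⁻¹).toReal := by simpa [ENNReal.toReal_inv] using hpos
    rw [memℓp_gen_iff hpos, ENNReal.rpow_lt_top_iff_of_pos h1]
    have h2 : ∀ i, ‖x i‖ₑ ^ r.toReal = ((‖x i‖₊ ^ r.toReal : NNReal) : ℝ≥0∞) := fun i => by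
      rw [enorm_eq_nnnorm, ENNReal.coe_rpow_of_nonneg _ hpos.le]
    simp only [h2, lt_top_iff_ne_top, ENNReal.tsum_coe_ne_top_iff_summable]
    rw [← NNReal.summable_coe]
    simp

theorem seqNorm_of_isEmpty [IsEmpty ι] {r : ℝ≥0∞} (hr : r ≠ 0) (x : ι → G) :
    seqNorm r x = 0 := by
  unfold seqNorm
  split_ifs with h
  · simp
  · have h1 : 0 < (r⁻¹).toReal := by
      simp [ENNReal.toReal_inv, ENNReal.toReal_pos hr h]
    rw [tsum_empty, ENNReal.zero_rpow_of_pos h1]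

theorem seqNorm_smul [NormedSpace ℂ G] {r : ℝ≥0∞} (hr : r ≠ 0) (c : ℂ) (x : ι → G) :
    seqNorm r (fun i => c • x i) = ‖c‖ₑ * seqNorm r x := by
  unfold seqNorm
  split_ifs with h
  · simp [enorm_smul, ENNReal.mul_iSup]
  · have h1 : r.toReal ≠ 0 := by simp [ENNReal.toReal_eq_zero_iff, hr, h]
    simp only [enorm_smul, ENNReal.mul_rpow_of_nonneg _ _ ENNReal.toReal_nonneg,
      ENNReal.tsum_mul_left]
    rw [← ENNReal.rpow_mul, ENNReal.toReal_inv,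
      mul_inv_cancel₀ h1, ENNReal.rpow_one]

theorem weakSeqNorm_smul [NormedSpace ℂ G] {r : ℝ≥0∞} (hr : r ≠ 0) (c : ℂ) (x : ι → G) :
    weakSeqNorm r (fun i => c • x i) = ‖c‖ₑ * weakSeqNorm r x := by
  unfold weakSeqNorm
  simp only [map_smul, seqNorm_smul hr, ENNReal.mul_iSup]

theorem seqNorm_le_iff {r : ℝ≥0∞} (hr : r ≠ 0) (x : ι → G) (δ : ℝ≥0∞) :
    seqNorm r x ≤ δ ^ (r⁻¹).toReal ↔
      if r = ∞ then ∀ i, ‖x i‖ₑ ≤ 1 else ∑' i, ‖x i‖ₑ ^ r.toReal ≤ δ := by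
  unfold seqNorm
  split_ifs with h
  · simp [h]
  · exact ENNReal.rpow_le_rpow_iff (by simp [ENNReal.toReal_inv, ENNReal.toReal_pos hr h])

theorem seqNorm_sumElim_le {r : ℝ≥0∞} (hr : r ≠ 0) {x : ι → G} {y : κ → G} {δ ε : ℝ≥0∞}
    (hx : seqNorm r x ≤ δ ^ (r⁻¹).toReal) (hy : seqNorm r y ≤ ε ^ (r⁻¹).toReal) :
    seqNorm r (Sum.elim x y) ≤ (δ + ε) ^ (r⁻¹).toReal := by
  rw [seqNorm_le_iff hr] at hx hy ⊢
  split_ifs at hx hy ⊢ with h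
  · rintro (i | i)
    · exact hx i
    · exact hy i
  · rw [ENNReal.summable.tsum_sum (f := fun i => ‖Sum.elim x y i‖ₑ ^ r.toReal) ENNReal.summable]
    exact add_le_add hx hy

theorem weakSeqNorm_le_iff [NormedSpace ℂ G] {r : ℝ≥0∞} (x : ι → G) (δ : ℝ≥0∞) :
    weakSeqNorm r x ≤ δ ↔
      ∀ φ : StrongDual ℂ G, ‖φ‖ ≤ 1 → seqNorm r (fun i => φ (x i)) ≤ δ := by
  simp [weakSeqNorm]

theorem seqNorm_comp_equiv (e : ι ≃ κ) (r : ℝ≥0∞) (x : κ → G) :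
    seqNorm r (fun i => x (e i)) = seqNorm r x := by
  unfold seqNorm
  rw [e.iSup_comp (g := fun i => ‖x i‖ₑ), e.tsum_eq (fun i => ‖x i‖ₑ ^ r.toReal)]

theorem weakSeqNorm_comp_equiv [NormedSpace ℂ G] (e : ι ≃ κ) (r : ℝ≥0∞) (x : κ → G) :
    weakSeqNorm r (fun i => x (e i)) = weakSeqNorm r x := by
  unfold weakSeqNorm
  simp only [fun φ : StrongDual ℂ G => seqNorm_comp_equiv e r (fun i => φ (x i))]

theorem seqNorm_lt_top [Finite ι] (r : ℝ≥0∞) (x : ι → G) : seqNorm r x < ∞ := by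
  have := Fintype.ofFinite ι
  unfold seqNorm
  split_ifs with h
  · refine lt_of_le_of_lt (iSup_le fun i => Finset.single_le_sum (f := fun i => ‖x i‖ₑ)
      (fun _ _ => bot_le) (Finset.mem_univ i)) ?_
    simp [ENNReal.sum_lt_top]
  · refine ENNReal.rpow_lt_top_of_nonneg ENNReal.toReal_nonneg ?_
    rw [tsum_fintype]
    refine (ENNReal.sum_lt_top.2 fun i _ => ?_).ne
    exact ENNReal.rpow_lt_top_of_nonneg ENNReal.toReal_nonneg (by simp)

theorem seqNorm_mono {G' : Type*} [NormedAddCommGroup G'] (r : ℝ≥0∞) {x : ι → G} {y : ι → G'}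
    (h : ∀ i, ‖x i‖ₑ ≤ ‖y i‖ₑ) : seqNorm r x ≤ seqNorm r y := by
  unfold seqNorm
  split_ifs
  · exact iSup_mono h
  · gcongr with i
    exact h i

theorem weakSeqNorm_le_seqNorm [NormedSpace ℂ G] (r : ℝ≥0∞) (x : ι → G) :
    weakSeqNorm r x ≤ seqNorm r x := by
  rw [weakSeqNorm_le_iff]
  intro φ hφ
  refine seqNorm_mono r fun i => ?_
  rw [enorm_le_iff_norm_le]
  exact (φ.le_of_opNorm_le hφ _).trans (by simp)

/-- Hölder's inequality. -/
theorem holder [Fintype ι] {H : Type*} [NormedAddCommGroup H] (p p' : ℝ≥0∞)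
    [hpp : p.HolderConjugate p'] (x : ι → G) (y : ι → H) :
    ∑ i, ‖x i‖ₑ * ‖y i‖ₑ ≤ seqNorm p x * seqNorm p' y := by
  by_cases hp : p = ∞
  · have hp' : p' = 1 := by
      have := (ENNReal.holderConjugate_iff.1 hpp)
      simpa [hp] using this
    simp only [seqNorm, hp, hp', if_true, ENNReal.one_ne_top, if_false, ENNReal.toReal_one,
      ENNReal.rpow_one, inv_one, tsum_fintype, Finset.mul_sum]
    gcongr with i
    exact le_iSup (fun i => ‖x i‖ₑ) i
  by_cases hp' : p' = ∞
  · have hp1 : p = 1 := by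
      have := (ENNReal.holderConjugate_iff.1 hpp)
      simpa [hp'] using this
    simp only [seqNorm, hp1, hp', if_true, ENNReal.one_ne_top, if_false, ENNReal.toReal_one,
      ENNReal.rpow_one, inv_one, tsum_fintype, Finset.sum_mul]
    gcongr with i
    exact le_iSup (fun i => ‖y i‖ₑ) i
  · have hc : Real.HolderTriple p.toReal p'.toReal (1 : ℝ≥0∞).toReal :=
      ENNReal.HolderTriple.toReal 1
        (ENNReal.toReal_pos (ENNReal.HolderConjugate.ne_zero p p') hp)
        (ENNReal.toReal_pos (ENNReal.HolderConjugate.ne_zero p' p) hp')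
    simp only [seqNorm, hp, hp', if_false, tsum_fintype]
    rw [ENNReal.toReal_one] at hc
    refine (ENNReal.inner_le_Lp_mul_Lq Finset.univ _ _ hc).trans_eq ?_
    simp [ENNReal.toReal_inv]

end SequenceNorms
section Tensor

variable {E F : Type*} [NormedAddCommGroup E] [NormedSpace ℂ E]
  [NormedAddCommGroup F] [NormedSpace ℂ F]

/-- The Chevet–Saphar norm `d_{p'}` on `E ⊗ F` (`p'` the conjugate exponent of `p`), with values
in `[0, ∞]`:
`d_{p'}(z) = inf {‖(x_j)‖_{p,w} ‖(y_j)‖_{p'} : z = ∑_{j<n} x_j ⊗ y_j}`. -/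
def chevetSapharENorm (p p' : ℝ≥0∞) (z : E ⊗[ℂ] F) : ℝ≥0∞ :=
  ⨅ (n : ℕ) (x : Fin n → E) (y : Fin n → F) (_ : z = ∑ j, x j ⊗ₜ[ℂ] y j),
    weakSeqNorm p x * seqNorm p' y

theorem chevetSapharENorm_le {ι : Type*} [Fintype ι] (p p' : ℝ≥0∞) {z : E ⊗[ℂ] F}
    (x : ι → E) (y : ι → F) (h : z = ∑ j, x j ⊗ₜ[ℂ] y j) :
    chevetSapharENorm p p' z ≤ weakSeqNorm p x * seqNorm p' y := by
  let e := (Fintype.equivFin ι).symm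
  rw [← weakSeqNorm_comp_equiv e, ← seqNorm_comp_equiv e]
  refine iInf_le_of_le _ (iInf_le_of_le (fun i => x (e i)) (iInf_le_of_le (fun i => y (e i))
    (iInf_le_of_le ?_ le_rfl)))
  rw [h, ← e.sum_comp]

theorem exists_of_chevetSapharENorm_lt {p p' : ℝ≥0∞} {z : E ⊗[ℂ] F} {δ : ℝ≥0∞}
    (h : chevetSapharENorm p p' z < δ) : ∃ (n : ℕ) (x : Fin n → E) (y : Fin n → F),
      z = ∑ j, x j ⊗ₜ[ℂ] y j ∧ weakSeqNorm p x * seqNorm p' y < δ := by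
  simpa only [chevetSapharENorm, iInf_lt_iff, exists_prop] using h

theorem exists_rep (z : E ⊗[ℂ] F) :
    ∃ (n : ℕ) (x : Fin n → E) (y : Fin n → F), z = ∑ j, x j ⊗ₜ[ℂ] y j := by
  obtain ⟨s, hs⟩ := TensorProduct.exists_finset z
  refine ⟨s.card, fun j => (s.equivFin.symm j).1.1, fun j => (s.equivFin.symm j).1.2, ?_⟩
  rw [hs, s.equivFin.symm.sum_comp (fun i => i.1.1 ⊗ₜ[ℂ] i.1.2),
    Finset.sum_coe_sort s (fun i => i.1 ⊗ₜ[ℂ] i.2)]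

theorem chevetSapharENorm_lt_top (p p' : ℝ≥0∞) (z : E ⊗[ℂ] F) :
    chevetSapharENorm p p' z < ∞ := by
  obtain ⟨n, x, y, h⟩ := exists_rep z
  exact (chevetSapharENorm_le p p' x y h).trans_lt (ENNReal.mul_lt_top
    ((weakSeqNorm_le_seqNorm p x).trans_lt (seqNorm_lt_top p x)) (seqNorm_lt_top p' y))

theorem exists_balanced {p p' : ℝ≥0∞} [p.HolderConjugate p'] {z : E ⊗[ℂ] F} {δ : ℝ≥0∞}
    (hδ : δ ≠ ∞) (h : chevetSapharENorm p p' z < δ) :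
    ∃ (n : ℕ) (x : Fin n → E) (y : Fin n → F), z = ∑ j, x j ⊗ₜ[ℂ] y j ∧
      weakSeqNorm p x ≤ δ ^ (p⁻¹).toReal ∧ seqNorm p' y ≤ δ ^ (p'⁻¹).toReal := by
  obtain ⟨n, x, y, hz, hlt⟩ := exists_of_chevetSapharENorm_lt h
  have hp := ENNReal.HolderConjugate.ne_zero p p'
  have hp' := ENNReal.HolderConjugate.ne_zero p' p
  have hδ0 : δ ≠ 0 := (bot_le.trans_lt hlt).ne'
  have hW : weakSeqNorm p x ≠ ∞ :=
    ((weakSeqNorm_le_seqNorm p x).trans_lt (seqNorm_lt_top p x)).ne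
  have hS : seqNorm p' y ≠ ∞ := (seqNorm_lt_top p' y).ne
  generalize hWd : weakSeqNorm p x = W at *
  generalize hSd : seqNorm p' y = S at *
  obtain ⟨W', h0, h1, h2, h3⟩ : ∃ W' : ℝ≥0∞, W' ≠ 0 ∧ W' ≠ ∞ ∧ W ≤ W' ∧ W' * S ≤ δ := by
    by_cases hS0 : S = 0
    · exact ⟨W + 1, by simp, by simp [hW], le_self_add, by simp [hS0]⟩
    · refine ⟨δ / S, ?_, ?_, ?_, ?_⟩
      · simp [ENNReal.div_eq_zero_iff, hδ0, hS]
      · simp [ENNReal.div_eq_top, hδ, hS0]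
      · exact (ENNReal.le_div_iff_mul_le (Or.inl hS0) (Or.inl hS)).2 hlt.le
      · rw [ENNReal.div_mul_cancel hS0 hS]
  set a := δ ^ (p⁻¹).toReal with ha
  set b := δ ^ (p'⁻¹).toReal with hb
  have hab : a * b = δ := by
    rw [ha, hb, ← ENNReal.rpow_add _ _ hδ0 hδ, ← ENNReal.toReal_add (by simpa) (by simpa),
      ENNReal.HolderConjugate.inv_add_inv_eq_one p p']
    simp
  have ha0 : a ≠ 0 := by rintro h; simp [h] at hab; exact hδ0 hab.symm
  have hat : a ≠ ∞ := (ENNReal.rpow_lt_top_of_nonneg ENNReal.toReal_nonneg hδ).ne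
  -- rescale by the positive real number `c = a / W'`
  have hc0 : a / W' ≠ 0 := by simp [ENNReal.div_eq_zero_iff, ha0, h1]
  have hct : a / W' ≠ ∞ := by simp [ENNReal.div_eq_top, hat, h0]
  set c : ℝ := (a / W').toReal with hc
  have hcpos : 0 < c := ENNReal.toReal_pos hc0 hct
  have hcc : ‖(c : ℂ)‖ₑ = a / W' := by
    rw [← ofReal_norm, Complex.norm_real, Real.norm_of_nonneg hcpos.le, hc,
      ENNReal.ofReal_toReal hct]
  have hcC : (c : ℂ) ≠ 0 := by exact_mod_cast hcpos.ne'
  refine ⟨n, fun j => (c : ℂ) • x j, fun j => (c : ℂ)⁻¹ • y j, ?_, ?_, ?_⟩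
  · simp only [TensorProduct.smul_tmul_smul, mul_inv_cancel₀ hcC, one_smul, hz]
  · rw [weakSeqNorm_smul hp, hcc, hWd]
    calc a / W' * W ≤ a / W' * W' := by gcongr
      _ = a := ENNReal.div_mul_cancel h0 h1
  · rw [seqNorm_smul hp', enorm_inv hcC, hcc, hSd, ENNReal.inv_div (Or.inl h1) (Or.inl h0)]
    rw [← ENNReal.mul_le_mul_iff_right ha0 hat, hab, ← mul_assoc,
      ENNReal.mul_div_cancel ha0 hat]
    exact h3

theorem chevetSapharENorm_add_le (p p' : ℝ≥0∞) [p.HolderConjugate p'] (z w : E ⊗[ℂ] F) :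
    chevetSapharENorm p p' (z + w) ≤ chevetSapharENorm p p' z + chevetSapharENorm p p' w := by
  have hp := ENNReal.HolderConjugate.ne_zero p p'
  have hp' := ENNReal.HolderConjugate.ne_zero p' p
  refine ENNReal.le_of_forall_pos_le_add fun ε hε hfin => ?_
  have hε' : (ε / 2 : ℝ≥0∞) ≠ 0 := by simp [hε.ne']
  have hεt : (ε / 2 : ℝ≥0∞) ≠ ∞ := by simp [ENNReal.div_eq_top]
  have hzt := (chevetSapharENorm_lt_top p p' z).ne
  have hwt := (chevetSapharENorm_lt_top p p' w).ne
  obtain ⟨n, x, y, hz, hx, hy⟩ := exists_balanced (p := p) (p' := p') (ENNReal.add_ne_top.2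
    ⟨hzt, hεt⟩) (ENNReal.lt_add_right hzt hε')
  obtain ⟨m, u, v, hw, hu, hv⟩ := exists_balanced (p := p) (p' := p') (ENNReal.add_ne_top.2
    ⟨hwt, hεt⟩) (ENNReal.lt_add_right hwt hε')
  set δ := chevetSapharENorm p p' z + ε / 2
  set η := chevetSapharENorm p p' w + ε / 2
  have hδη : δ + η = chevetSapharENorm p p' z + chevetSapharENorm p p' w + ε := by
    simp only [δ, η]
    rw [add_add_add_comm, ENNReal.add_halves]
  have hst : δ + η ≠ ∞ := by
    simp only [δ, η, ENNReal.add_ne_top]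
    exact ⟨⟨hzt, hεt⟩, ⟨hwt, hεt⟩⟩
  have hs0 : δ + η ≠ 0 := by
    rw [hδη]; simp [hε.ne']
  refine (chevetSapharENorm_le p p' (Sum.elim x u) (Sum.elim y v) (by simp [hz, hw])).trans ?_
  have h1 : weakSeqNorm p (Sum.elim x u) ≤ (δ + η) ^ (p⁻¹).toReal := by
    rw [weakSeqNorm_le_iff] at hx hu ⊢
    intro φ hφ
    have : (fun i => φ (Sum.elim x u i)) = Sum.elim (fun i => φ (x i)) (fun i => φ (u i)) := by
      ext (i | i) <;> rfl
    rw [this]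
    exact seqNorm_sumElim_le hp (hx φ hφ) (hu φ hφ)
  calc weakSeqNorm p (Sum.elim x u) * seqNorm p' (Sum.elim y v)
      ≤ (δ + η) ^ (p⁻¹).toReal * (δ + η) ^ (p'⁻¹).toReal :=
        mul_le_mul' h1 (seqNorm_sumElim_le hp' hy hv)
    _ = δ + η := by
        rw [← ENNReal.rpow_add _ _ hs0 hst, ← ENNReal.toReal_add (by simpa) (by simpa),
          ENNReal.HolderConjugate.inv_add_inv_eq_one p p']
        simp
    _ = _ := hδη

theorem chevetSapharENorm_smul_le (p p' : ℝ≥0∞) [p.HolderConjugate p'] (c : ℂ) (z : E ⊗[ℂ] F) :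
    chevetSapharENorm p p' (c • z) ≤ ‖c‖ₑ * chevetSapharENorm p p' z := by
  have hp' := ENNReal.HolderConjugate.ne_zero p' p
  by_cases hc : c = 0
  · obtain ⟨n, x, y, hz⟩ := exists_rep z
    refine (chevetSapharENorm_le p p' x (fun j => c • y j)
      (by simp [hz, Finset.smul_sum])).trans ?_
    rw [seqNorm_smul hp', hc]
    simp
  · have hc0 : ‖c‖ₑ ≠ 0 := by simpa using hc
    have hct : ‖c‖ₑ ≠ ∞ := by simp
    rw [mul_comm, ← ENNReal.div_le_iff_le_mul (Or.inl hc0) (Or.inl hct),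
      chevetSapharENorm.eq_def p p' z]
    refine le_iInf fun n => le_iInf fun x => le_iInf fun y => le_iInf fun hz => ?_
    rw [ENNReal.div_le_iff_le_mul (Or.inl hc0) (Or.inl hct)]
    refine (chevetSapharENorm_le p p' x (fun j => c • y j)
      (by simp [hz, Finset.smul_sum])).trans ?_
    rw [seqNorm_smul hp']
    exact (by ring : _ = _).le

theorem chevetSapharENorm_zero (p p' : ℝ≥0∞) [p.HolderConjugate p'] :
    chevetSapharENorm p p' (0 : E ⊗[ℂ] F) = 0 := by
  have hp' := ENNReal.HolderConjugate.ne_zero p' p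
  refine le_antisymm ?_ bot_le
  refine (chevetSapharENorm_le p p' (ι := Fin 0) Fin.elim0 Fin.elim0 (by simp)).trans ?_
  rw [seqNorm_of_isEmpty hp', mul_zero]

/-- The Chevet–Saphar norm `d_{p'}` as a real-valued seminorm on `E ⊗ F`. -/
def chevetSaphar (p p' : ℝ≥0∞) [p.HolderConjugate p'] : Seminorm ℂ (E ⊗[ℂ] F) :=
  Seminorm.ofSMulLE (fun z => (chevetSapharENorm p p' z).toReal)
    (by simp [chevetSapharENorm_zero])
    (fun z w => by
      rw [← ENNReal.toReal_add (chevetSapharENorm_lt_top p p' z).ne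
        (chevetSapharENorm_lt_top p p' w).ne]
      exact ENNReal.toReal_mono (ENNReal.add_ne_top.2 ⟨(chevetSapharENorm_lt_top p p' z).ne,
        (chevetSapharENorm_lt_top p p' w).ne⟩) (chevetSapharENorm_add_le p p' z w))
    (fun c z => by
      have h := ENNReal.toReal_mono (ENNReal.mul_ne_top (by simp)
        (chevetSapharENorm_lt_top p p' z).ne) (chevetSapharENorm_smul_le p p' c z)
      simpa [ENNReal.toReal_mul] using h)

variable (E F) in
/-- The algebraic tensor product `E ⊗ F`, as a type that carries the norm `d_{p'}`. -/
@[nolint unusedArguments]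
def TensorD (_p _p' : ℝ≥0∞) : Type _ := E ⊗[ℂ] F

instance (p p' : ℝ≥0∞) : AddCommGroup (TensorD E F p p') :=
  inferInstanceAs (AddCommGroup (E ⊗[ℂ] F))

instance (p p' : ℝ≥0∞) : Module ℂ (TensorD E F p p') :=
  inferInstanceAs (Module ℂ (E ⊗[ℂ] F))

instance (p p' : ℝ≥0∞) [p.HolderConjugate p'] : SeminormedAddCommGroup (TensorD E F p p') :=
  (show Seminorm ℂ (TensorD E F p p') from
    chevetSaphar (E := E) (F := F) p p').toAddGroupSeminorm.toSeminormedAddCommGroup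

instance (p p' : ℝ≥0∞) [p.HolderConjugate p'] : NormedSpace ℂ (TensorD E F p p') where
  norm_smul_le c z := ((chevetSaphar (E := E) (F := F) p p').smul' c z).le

variable (E F) in
/-- The completed tensor product `E ⊗̂_{d_{p'}} F`, a Banach space. -/
abbrev CompletedTensorD (p p' : ℝ≥0∞) [p.HolderConjugate p'] : Type _ :=
  UniformSpace.Completion (TensorD E F p p')

/-- An element of `E ⊗ F`, seen in `E ⊗̂_{d_{p'}} F`. -/
def toCompletedTensorD (p p' : ℝ≥0∞) [p.HolderConjugate p'] (z : E ⊗[ℂ] F) :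
    CompletedTensorD E F p p' :=
  UniformSpace.Completion.toComplL (𝕜 := ℂ) (E := TensorD E F p p') z

theorem norm_toCompletedTensorD (p p' : ℝ≥0∞) [p.HolderConjugate p'] (z : E ⊗[ℂ] F) :
    ‖toCompletedTensorD p p' z‖ = (chevetSapharENorm p p' z).toReal :=
  UniformSpace.Completion.norm_coe (E := TensorD E F p p') z

end Tensor

section Summing

variable {E F G : Type*} [NormedAddCommGroup E] [NormedSpace ℂ E]
  [NormedAddCommGroup F] [NormedSpace ℂ F] [NormedAddCommGroup G] [NormedSpace ℂ G]

/-- `T` is `p`-summing: `‖(T x_k)_{k<n}‖_p ≤ C ‖(x_k)_{k<n}‖_{p,w}` for all finite families. -/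
def IsSumming (p : ℝ≥0∞) (T : E →L[ℂ] G) : Prop :=
  ∃ C : ℝ, 0 < C ∧ ∀ (n : ℕ) (x : Fin n → E),
    seqNorm p (fun k => T (x k)) ≤ ENNReal.ofReal C * weakSeqNorm p x

variable (E G) in
/-- The space `Π_p(E, G)` of `p`-summing operators. -/
abbrev SummingOp (p : ℝ≥0∞) : Type _ := {T : E →L[ℂ] G // IsSumming p T}

/-- The linear functional `∑ x_j ⊗ y_j ↦ ∑ ⟨T x_j, y_j⟩` on `E ⊗ F`. -/
def tensorFunctional (T : E →L[ℂ] StrongDual ℂ F) : E ⊗[ℂ] F →ₗ[ℂ] ℂ :=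
  TensorProduct.lift (ContinuousLinearMap.coeLM ℂ ∘ₗ T.toLinearMap)

theorem tensorFunctional_sum {ι : Type*} [Fintype ι]
    (T : E →L[ℂ] StrongDual ℂ F) (x : ι → E) (y : ι → F) :
    tensorFunctional T (∑ j, x j ⊗ₜ[ℂ] y j) = ∑ j, T (x j) (y j) := by
  simp [tensorFunctional]

theorem tensorFunctional_le {p p' : ℝ≥0∞} [p.HolderConjugate p'] {T : E →L[ℂ] StrongDual ℂ F}
    {C : ℝ} (hC : 0 < C) (h : ∀ (n : ℕ) (x : Fin n → E),
      seqNorm p (fun k => T (x k)) ≤ ENNReal.ofReal C * weakSeqNorm p x)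
    (z : E ⊗[ℂ] F) :
    ‖tensorFunctional T z‖ ≤ C * (chevetSapharENorm p p' z).toReal := by
  have key : ‖tensorFunctional T z‖ₑ ≤ ENNReal.ofReal C * chevetSapharENorm p p' z := by
    have hC0 : ENNReal.ofReal C ≠ 0 := by simpa using hC
    rw [mul_comm, ← ENNReal.div_le_iff_le_mul (Or.inl hC0) (Or.inl ENNReal.ofReal_ne_top),
      chevetSapharENorm.eq_def]
    refine le_iInf fun n => le_iInf fun x => le_iInf fun y => le_iInf fun hz => ?_
    rw [ENNReal.div_le_iff_le_mul (Or.inl hC0) (Or.inl ENNReal.ofReal_ne_top), hz,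
      tensorFunctional_sum]
    calc ‖∑ j, T (x j) (y j)‖ₑ ≤ ∑ j, ‖T (x j) (y j)‖ₑ := enorm_sum_le _ _
      _ ≤ ∑ j, ‖T (x j)‖ₑ * ‖y j‖ₑ := by
          gcongr with j
          exact (T (x j)).le_opENorm (y j)
      _ ≤ seqNorm p (fun j => T (x j)) * seqNorm p' y := holder p p' _ _
      _ ≤ (ENNReal.ofReal C * weakSeqNorm p x) * seqNorm p' y := by gcongr; exact h n x
      _ = _ := by ring
  have := ENNReal.toReal_mono (ENNReal.mul_ne_top (by simp)
    (chevetSapharENorm_lt_top p p' _).ne) key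
  rw [ENNReal.toReal_mul, ENNReal.toReal_ofReal hC.le, toReal_enorm] at this
  exact this

/-- The functional on `E ⊗̂_{d_{p'}} F` that corresponds to `T ∈ Π_p(E, F*)` under the duality
`(E ⊗̂_{d_{p'}} F)* = Π_p(E, F*)`: the continuous extension of
`∑ x_j ⊗ y_j ↦ ∑ ⟨T x_j, y_j⟩`. -/
def SummingOp.toDual {p : ℝ≥0∞} (p' : ℝ≥0∞) [p.HolderConjugate p']
    (T : SummingOp E (StrongDual ℂ F) p) : StrongDual ℂ (CompletedTensorD E F p p') :=
  ContinuousLinearMap.extend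
    (LinearMap.mkContinuousOfExistsBound (E := TensorD E F p p')
      (tensorFunctional T.1) (let ⟨C, hC, h⟩ := T.2; ⟨C, tensorFunctional_le hC h⟩))
    (UniformSpace.Completion.toComplL (𝕜 := ℂ) (E := TensorD E F p p'))

theorem SummingOp.toDual_sum {ι : Type*} [Fintype ι] {p : ℝ≥0∞} (p' : ℝ≥0∞)
    [p.HolderConjugate p'] (T : SummingOp E (StrongDual ℂ F) p) (x : ι → E) (y : ι → F) :
    T.toDual p' (toCompletedTensorD p p' (∑ j, x j ⊗ₜ[ℂ] y j)) = ∑ j, T.1 (x j) (y j) := by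
  rw [← tensorFunctional_sum]
  exact ContinuousLinearMap.extend_eq
    (e := UniformSpace.Completion.toComplL (𝕜 := ℂ) (E := TensorD E F p p')) _
    UniformSpace.Completion.denseRange_coe (UniformSpace.Completion.isUniformInducing_coe _) _

end Summing

section Gelfand

variable {Ω : Type*} [MeasurableSpace Ω]

/-- Weak* measurability of an operator-valued function `A : Ω → B(E, F*)`: all scalar functions
`t ↦ ⟨A_t x, y⟩` are measurable. These are the pairings with the elementary tensors `x ⊗ y` of
the predual `E ⊗̂_π F` of `B(E, F*)`; they span a dense subspace, so that all other pairings are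
pointwise limits of linear combinations of them. -/
def IsWeakStarMeasurable {E F : Type*} [NormedAddCommGroup E] [NormedSpace ℂ E]
    [NormedAddCommGroup F] [NormedSpace ℂ F] (A : Ω → E →L[ℂ] StrongDual ℂ F) : Prop :=
  ∀ (x : E) (y : F), Measurable fun t => A t x y

/-- Weak* integrability (Gel'fand integrability) of a function with values in the dual of `X`. -/
def IsGelfandIntegrable {X : Type*} [NormedAddCommGroup X] [NormedSpace ℂ X]
    (f : Ω → StrongDual ℂ X) (μ : Measure Ω) : Prop :=
  ∀ z : X, Measurable (fun t => f t z) ∧ Integrable (fun t => f t z) μ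

/-- The Gel'fand norm `sup_{‖z‖ ≤ 1} ∫ |⟨f(t), z⟩| dμ(t)`. -/
def gelfandNorm {X : Type*} [NormedAddCommGroup X] [NormedSpace ℂ X]
    (f : Ω → StrongDual ℂ X) (μ : Measure Ω) : ℝ≥0∞ :=
  ⨆ (z : X) (_ : ‖z‖ ≤ 1), ∫⁻ t, ‖f t z‖ₑ ∂μ

end Gelfand

end GelfandSumming

end

/-!
The finiteness of the bound is a gliding hump argument. If the supremum `S` over the unit balls of
`ℓ_p^w(E)` and `ℓ_{p'}(F)` were infinite, there would be pairs `(x^k, y^k)` in these balls whose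
integrals exceed `4^k`. Scaling them by `2^{-k/p}` and `2^{-k/p'}` and concatenating all of them
gives one pair in `ℓ_p^w(E) × ℓ_{p'}(F)` whose integral is at least `2^{-k} 4^k = 2^k` for each
`k`, against the hypothesis (`iSup_lintegral_lt_top`).

The function `f` is `A`, set to zero on a measurable null set outside of which `A` is `p`-summing.
A tensor `z` with `d_{p'}(z) < 1` has a representation by finite families in the two unit balls;
extended by zero, they show `∫ |⟨f(t), z⟩| dμ(t) ≤ S` (`lintegral_tensorFunctional_le`).
Every point of the open unit ball of the completion is the limit of a sequence of such tensors, so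
measurability passes to the pointwise limit, and the estimate by Fatou's lemma
(`lintegral_toDual_le`). The closed unit ball and integrability follow by scaling.
-/

open Filter Topology

namespace GelfandSumming

/-! ### Concatenation and extension of families -/

section Families

variable {ι κ G : Type*} [NormedAddCommGroup G]

/-- Concatenation of families in `ℓ_r`: the `r`-th powers of the
norms add up. -/
theorem seqNorm_uncurry_le {r : ℝ≥0∞} (hr : r ≠ 0) {x : ι → κ → G} {w : ι → ℝ≥0∞}
    (hx : ∀ k, seqNorm r (x k) ≤ w k ^ (r⁻¹).toReal) :
    seqNorm r (fun i : ι × κ => x i.1 i.2) ≤ (∑' k, w k) ^ (r⁻¹).toReal := by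
  simp only [seqNorm_le_iff hr] at hx ⊢
  split_ifs at hx ⊢ with h
  · exact fun i => hx i.1 i.2
  · rw [ENNReal.tsum_prod (f := fun k j => ‖x k j‖ₑ ^ r.toReal)]
    exact ENNReal.tsum_le_tsum hx

theorem weakSeqNorm_uncurry_le [NormedSpace ℂ G] {r : ℝ≥0∞} (hr : r ≠ 0) {x : ι → κ → G}
    {w : ι → ℝ≥0∞} (hx : ∀ k, weakSeqNorm r (x k) ≤ w k ^ (r⁻¹).toReal) :
    weakSeqNorm r (fun i : ι × κ => x i.1 i.2) ≤ (∑' k, w k) ^ (r⁻¹).toReal := by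
  simp only [weakSeqNorm_le_iff] at hx ⊢
  exact fun φ hφ => seqNorm_uncurry_le hr fun k => hx k φ hφ

theorem seqNorm_extend_zero_le {r : ℝ≥0∞} (hr : r ≠ 0) {e : ι → κ} (he : Function.Injective e)
    (x : ι → G) : seqNorm r (Function.extend e x 0) ≤ seqNorm r x := by
  unfold seqNorm
  split_ifs with h
  · refine iSup_le fun i => ?_
    by_cases hi : ∃ j, e j = i
    · obtain ⟨j, rfl⟩ := hi
      rw [he.extend_apply]
      exact le_iSup (fun j => ‖x j‖ₑ) j
    · simp [Function.extend_apply' _ _ _ hi]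
  · refine (congrArg (· ^ (r⁻¹).toReal) ?_).le
    rw [← tsum_extend_zero he]
    refine tsum_congr fun i => ?_
    by_cases hi : ∃ j, e j = i
    · obtain ⟨j, rfl⟩ := hi
      simp [he.extend_apply]
    · simp [Function.extend_apply' _ _ _ hi, ENNReal.toReal_pos hr h]

theorem weakSeqNorm_extend_zero_le [NormedSpace ℂ G] {r : ℝ≥0∞} (hr : r ≠ 0) {e : ι → κ}
    (he : Function.Injective e) (x : ι → G) :
    weakSeqNorm r (Function.extend e x 0) ≤ weakSeqNorm r x := by
  refine iSup₂_mono fun φ _ => ?_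
  have : (fun i => φ (Function.extend e x 0 i)) = Function.extend e (fun i => φ (x i)) 0 := by
    ext i
    by_cases hi : ∃ j, e j = i
    · obtain ⟨j, rfl⟩ := hi
      simp [he.extend_apply]
    · simp [Function.extend_apply' _ _ _ hi]
  rw [this]
  exact seqNorm_extend_zero_le hr he _

/-- A sequence of finite weak `ℓ_r`-norm lies in `ℓ_r^w(G)`; functionals of norm greater than `1`
are covered by scaling. -/
theorem MemWeakEll.of_weakSeqNorm_lt_top [NormedSpace ℂ G] {r : ℝ≥0∞} (hr : r ≠ 0) {x : ℕ → G}
    (hx : weakSeqNorm r x < ∞) : MemWeakEll r x := by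
  intro φ
  have hc : (0 : ℝ) < ‖φ‖ + 1 := by positivity
  have hcC : ((‖φ‖ + 1 : ℝ) : ℂ) ≠ 0 := by exact_mod_cast hc.ne'
  set ψ : StrongDual ℂ G := ((‖φ‖ + 1 : ℝ) : ℂ)⁻¹ • φ with hψ
  have h1 : ‖ψ‖ ≤ 1 := by
    rw [hψ, norm_smul, norm_inv, Complex.norm_real, Real.norm_of_nonneg hc.le,
      inv_mul_le_iff₀ hc]
    linarith
  have h2 : (fun n => φ (x n)) = fun n => ((‖φ‖ + 1 : ℝ) : ℂ) • ψ (x n) := by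
    ext n
    simp only [hψ, _root_.smul_apply, smul_smul, mul_inv_cancel₀ hcC, one_smul]
  rw [MemEll, h2, seqNorm_smul hr]
  exact ENNReal.mul_lt_top (by simp) (((weakSeqNorm_le_iff x _).1 le_rfl ψ h1).trans_lt hx)

end Families

/-! ### Uniform bounds -/

section Bounds

variable {Ω : Type*} [MeasurableSpace Ω] {μ : Measure Ω} {E F : Type*}
  [NormedAddCommGroup E] [NormedSpace ℂ E] [NormedAddCommGroup F] [NormedSpace ℂ F]
  {p p' : ℝ≥0∞} [p.HolderConjugate p'] {A : Ω → E →L[ℂ] StrongDual ℂ F}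

/-- Gliding hump: if the integrals of `∑ |⟨A_t x_n, y_n⟩|` are finite for all
`(x, y) ∈ ℓ_p^w(E) × ℓ_{p'}(F)`, then they are bounded on the product of the unit balls. -/
theorem iSup_lintegral_lt_top
    (hsum : ∀ (x : ℕ → E) (y : ℕ → F), MemWeakEll p x → MemEll p' y →
      ∫⁻ t, ∑' n, ‖A t (x n) (y n)‖ₑ ∂μ < ∞) :
    (⨆ (x : ℕ → E) (y : ℕ → F) (_ : weakSeqNorm p x ≤ 1) (_ : seqNorm p' y ≤ 1),
      ∫⁻ t, ∑' n, ‖A t (x n) (y n)‖ₑ ∂μ) < ∞ := by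
  have hp := ENNReal.HolderConjugate.ne_zero p p'
  have hp' := ENNReal.HolderConjugate.ne_zero p' p
  by_contra hS
  rw [not_lt_top_iff] at hS
  have hex : ∀ k : ℕ, ∃ (x : ℕ → E) (y : ℕ → F), weakSeqNorm p x ≤ 1 ∧ seqNorm p' y ≤ 1 ∧
      (4 : ℝ≥0∞) ^ k < ∫⁻ t, ∑' n, ‖A t (x n) (y n)‖ₑ ∂μ := by
    intro k
    have : (4 : ℝ≥0∞) ^ k < ∞ := by simp [ENNReal.pow_lt_top_iff]
    rw [← hS] at this
    simpa only [lt_iSup_iff, exists_prop] using this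
  choose x y hx hy hI using hex
  -- the weights `2^{-k}`, split as `2^{-k/p} 2^{-k/p'}`
  set w : ℕ → ℝ≥0∞ := fun k => 2⁻¹ ^ k with hw
  have hw0 : ∀ k, w k ≠ 0 := fun k => by simp [hw]
  have hwt : ∀ k, w k ≠ ∞ := fun k => by simp [hw]
  have hwsum : ∑' k, w k ≠ ∞ := by
    rw [hw, ENNReal.tsum_geometric, ENNReal.one_sub_inv_two]
    simp
  have hscalar : ∀ (s : ℝ) (k : ℕ), 0 ≤ s → ∃ c : ℂ, ‖c‖ₑ = w k ^ s := by
    intro s k hs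
    refine ⟨((w k ^ s).toReal : ℂ), ?_⟩
    rw [← ofReal_norm, Complex.norm_real, Real.norm_of_nonneg ENNReal.toReal_nonneg,
      ENNReal.ofReal_toReal (ENNReal.rpow_lt_top_of_nonneg hs (hwt k)).ne]
  choose c hc using fun k => hscalar (p⁻¹).toReal k ENNReal.toReal_nonneg
  choose d hd using fun k => hscalar (p'⁻¹).toReal k ENNReal.toReal_nonneg
  have hcd : ∀ k, ‖c k‖ₑ * ‖d k‖ₑ = w k := by
    intro k
    rw [hc, hd, ← ENNReal.rpow_add _ _ (hw0 k) (hwt k), ← ENNReal.toReal_add (by simpa) (by simpa),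
      ENNReal.HolderConjugate.inv_add_inv_eq_one p p']
    simp
  set X : ℕ × ℕ → E := fun i => c i.1 • x i.1 i.2 with hX
  set Y : ℕ × ℕ → F := fun i => d i.1 • y i.1 i.2 with hY
  have hXw : weakSeqNorm p X < ∞ := by
    refine (weakSeqNorm_uncurry_le (x := fun k j => c k • x k j) (w := w) hp fun k => ?_).trans_lt
      (ENNReal.rpow_lt_top_of_nonneg ENNReal.toReal_nonneg hwsum)
    rw [weakSeqNorm_smul hp, hc]
    exact mul_le_of_le_one_right' (hx k)
  have hYw : seqNorm p' Y < ∞ := by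
    refine (seqNorm_uncurry_le (x := fun k j => d k • y k j) (w := w) hp' fun k => ?_).trans_lt
      (ENNReal.rpow_lt_top_of_nonneg ENNReal.toReal_nonneg hwsum)
    rw [seqNorm_smul hp', hd]
    exact mul_le_of_le_one_right' (hy k)
  let e : ℕ ≃ ℕ × ℕ := Nat.pairEquiv.symm
  have hfin := hsum (fun n => X (e n)) (fun n => Y (e n))
    (MemWeakEll.of_weakSeqNorm_lt_top hp (by rwa [weakSeqNorm_comp_equiv e]))
    (by rwa [MemEll, seqNorm_comp_equiv e])
  have hlow : ∀ k : ℕ, (2 : ℝ≥0∞) ^ k ≤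
      ∫⁻ t, ∑' n, ‖A t (X (e n)) (Y (e n))‖ₑ ∂μ := by
    intro k
    calc (2 : ℝ≥0∞) ^ k = w k * 4 ^ k := by
          rw [hw, ← mul_pow, show (4 : ℝ≥0∞) = 2 * 2 by norm_num, ← mul_assoc,
            ENNReal.inv_mul_cancel (by simp) (by simp), one_mul]
      _ ≤ w k * ∫⁻ t, ∑' n, ‖A t (x k n) (y k n)‖ₑ ∂μ := by gcongr; exact (hI k).le
      _ = ∫⁻ t, ∑' n, ‖A t (X (k, n)) (Y (k, n))‖ₑ ∂μ := by
          rw [← lintegral_const_mul' _ _ (hwt k)]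
          refine lintegral_congr fun t => ?_
          rw [← ENNReal.tsum_mul_left, ← hcd]
          refine tsum_congr fun n => ?_
          simp only [hX, hY, map_smul, _root_.smul_apply, enorm_smul]
          ring
      _ ≤ _ := by
          refine lintegral_mono fun t => ?_
          simp only
          rw [e.tsum_eq (fun i => ‖A t (X i) (Y i)‖ₑ)]
          exact ENNReal.tsum_comp_le_tsum_of_injective (Prod.mk_right_injective k)
            (fun i => ‖A t (X i) (Y i)‖ₑ)
  obtain ⟨k, hk⟩ := ENNReal.exists_nat_gt hfin.ne
  refine absurd (hk.trans_le ?_) (hlow k).not_gt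
  exact_mod_cast Nat.lt_two_pow_self.le

/-- On algebraic tensors with `d_{p'}(z) < 1`, the integral of `|⟨A_t, z⟩|` is bounded by the
supremum over the unit balls of `ℓ_p^w(E)` and `ℓ_{p'}(F)`. -/
theorem lintegral_tensorFunctional_le {z : E ⊗[ℂ] F} (hz : chevetSapharENorm p p' z < 1) :
    ∫⁻ t, ‖tensorFunctional (A t) z‖ₑ ∂μ ≤
      ⨆ (x : ℕ → E) (y : ℕ → F) (_ : weakSeqNorm p x ≤ 1) (_ : seqNorm p' y ≤ 1),
        ∫⁻ t, ∑' n, ‖A t (x n) (y n)‖ₑ ∂μ := by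
  have hp := ENNReal.HolderConjugate.ne_zero p p'
  have hp' := ENNReal.HolderConjugate.ne_zero p' p
  obtain ⟨n, x, y, rfl, hx, hy⟩ := exists_balanced ENNReal.one_ne_top hz
  rw [ENNReal.one_rpow] at hx hy
  have he : Function.Injective (Fin.val : Fin n → ℕ) := Fin.val_injective
  set X : ℕ → E := Function.extend Fin.val x 0 with hX
  set Y : ℕ → F := Function.extend Fin.val y 0 with hY
  have hXw : weakSeqNorm p X ≤ 1 := (weakSeqNorm_extend_zero_le hp he x).trans hx
  have hYw : seqNorm p' Y ≤ 1 := (seqNorm_extend_zero_le hp' he y).trans hy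
  refine le_iSup_of_le X (le_iSup_of_le Y (le_iSup_of_le hXw (le_iSup_of_le hYw ?_)))
  refine lintegral_mono fun t => ?_
  simp only [tensorFunctional_sum]
  refine (enorm_sum_le _ _).trans ?_
  refine le_of_eq_of_le ?_ (ENNReal.tsum_comp_le_tsum_of_injective he
    fun k => ‖A t (X k) (Y k)‖ₑ)
  simp only [hX, hY, he.extend_apply, tsum_fintype]

end Bounds

/-! ### Functions with values in `Π_p(E, F*)` -/

section SummingValued

variable {Ω : Type*} [MeasurableSpace Ω] {μ : Measure Ω} {E F : Type*}
  [NormedAddCommGroup E] [NormedSpace ℂ E] [NormedAddCommGroup F] [NormedSpace ℂ F]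
  {p p' : ℝ≥0∞} [p.HolderConjugate p']

theorem isSumming_zero {G : Type*} [NormedAddCommGroup G] [NormedSpace ℂ G] (hp : p ≠ 0) :
    IsSumming p (0 : E →L[ℂ] G) := by
  refine ⟨1, one_pos, fun n x => ?_⟩
  have h := seqNorm_smul hp (0 : ℂ) (fun _ : Fin n => (0 : G))
  simp only [smul_zero, enorm_zero, zero_mul] at h
  simp [h]

theorem SummingOp.toDual_toCompletedTensorD (T : SummingOp E (StrongDual ℂ F) p) (z : E ⊗[ℂ] F) :
    T.toDual p' (toCompletedTensorD p p' z) = tensorFunctional T.1 z := by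
  obtain ⟨n, x, y, rfl⟩ := exists_rep z
  rw [SummingOp.toDual_sum, tensorFunctional_sum]

theorem exists_seq_tendsto_toCompletedTensorD (z : CompletedTensorD E F p p') :
    ∃ u : ℕ → E ⊗[ℂ] F, Tendsto (fun n => toCompletedTensorD p p' (u n)) atTop (𝓝 z) := by
  have hz : z ∈ closure (Set.range ((↑) : TensorD E F p p' → CompletedTensorD E F p p')) :=
    UniformSpace.Completion.denseRange_coe z
  obtain ⟨v, hv, hlim⟩ := mem_closure_iff_seq_limit.1 hz
  choose u hu using hv
  refine ⟨u, ?_⟩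
  convert hlim using 2 with n
  exact hu n

variable {f : Ω → SummingOp E (StrongDual ℂ F) p}

theorem measurable_tensorFunctional {A : Ω → E →L[ℂ] StrongDual ℂ F}
    (hA : IsWeakStarMeasurable A) (z : E ⊗[ℂ] F) :
    Measurable fun t => tensorFunctional (A t) z := by
  obtain ⟨n, x, y, rfl⟩ := exists_rep z
  simp only [tensorFunctional_sum]
  exact Finset.measurable_fun_sum _ fun j _ => hA (x j) (y j)

theorem measurable_toDual (hf : IsWeakStarMeasurable fun t => (f t).1)
    (z : CompletedTensorD E F p p') : Measurable fun t => (f t).toDual p' z := by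
  obtain ⟨u, hu⟩ := exists_seq_tendsto_toCompletedTensorD z
  refine measurable_of_tendsto_metrizable (fun n => measurable_tensorFunctional hf (u n))
    (tendsto_pi_nhds.2 fun t => ?_)
  simpa only [Function.comp_def, SummingOp.toDual_toCompletedTensorD] using
    (((f t).toDual p').continuous.tendsto z).comp hu

/-- A bound on the integrals of `|⟨f(t), z⟩|` for algebraic tensors in the open unit ball extends
to the open unit ball of the completion, by Fatou's lemma. -/
theorem lintegral_toDual_le (hf : IsWeakStarMeasurable fun t => (f t).1) {S : ℝ≥0∞}
    (hS : ∀ z : E ⊗[ℂ] F, chevetSapharENorm p p' z < 1 →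
      ∫⁻ t, ‖tensorFunctional (f t).1 z‖ₑ ∂μ ≤ S)
    {z : CompletedTensorD E F p p'} (hz : ‖z‖ < 1) :
    ∫⁻ t, ‖(f t).toDual p' z‖ₑ ∂μ ≤ S := by
  obtain ⟨u, hu⟩ := exists_seq_tendsto_toCompletedTensorD z
  have hball : ∀ᶠ n in atTop, chevetSapharENorm p p' (u n) < 1 := by
    filter_upwards [hu.norm.eventually_lt_const hz] with n hn
    rw [norm_toCompletedTensorD, ← ENNReal.toReal_one] at hn
    exact (ENNReal.toReal_lt_toReal (chevetSapharENorm_lt_top p p' _).ne ENNReal.one_ne_top).1 hn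
  calc ∫⁻ t, ‖(f t).toDual p' z‖ₑ ∂μ
      = ∫⁻ t, liminf (fun n => ‖tensorFunctional (f t).1 (u n)‖ₑ) atTop ∂μ := by
        refine lintegral_congr fun t => (Tendsto.liminf_eq ?_).symm
        simpa only [Function.comp_def, SummingOp.toDual_toCompletedTensorD] using
          ((((f t).toDual p').continuous.tendsto z).comp hu).enorm
    _ ≤ liminf (fun n => ∫⁻ t, ‖tensorFunctional (f t).1 (u n)‖ₑ ∂μ) atTop :=
        lintegral_liminf_le fun n => (measurable_tensorFunctional hf (u n)).enorm
    _ ≤ S := liminf_le_of_frequently_le' (hball.mono fun n hn => hS _ hn).frequently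

end SummingValued

/-! ### Weak* integrability from bounds on the open unit ball -/

section Gelfand

variable {Ω : Type*} [MeasurableSpace Ω] {μ : Measure Ω} {X : Type*}
  [NormedAddCommGroup X] [NormedSpace ℂ X] {g : Ω → StrongDual ℂ X} {S : ℝ≥0∞}

theorem lintegral_apply_smul (g : Ω → StrongDual ℂ X) (c : ℂ) (z : X) :
    ∫⁻ t, ‖g t (c • z)‖ₑ ∂μ = ‖c‖ₑ * ∫⁻ t, ‖g t z‖ₑ ∂μ := by
  simp only [map_smul, enorm_smul]
  exact lintegral_const_mul' _ _ (by simp)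

theorem gelfandNorm_le_of_ball (hS : ∀ z : X, ‖z‖ < 1 → ∫⁻ t, ‖g t z‖ₑ ∂μ ≤ S) :
    gelfandNorm g μ ≤ S := by
  refine iSup₂_le fun z hz => ?_
  -- `c • z` lies in the open unit ball for `0 < c < 1`; then let `c` tend to `1`
  have hlim : Tendsto (fun c : ℝ => ENNReal.ofReal c * ∫⁻ t, ‖g t z‖ₑ ∂μ) (𝓝[<] 1)
      (𝓝 (∫⁻ t, ‖g t z‖ₑ ∂μ)) := by
    have h := ENNReal.Tendsto.mul_const (b := ∫⁻ t, ‖g t z‖ₑ ∂μ)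
      ((ENNReal.continuous_ofReal.tendsto 1).mono_left (nhdsWithin_le_nhds (s := Set.Iio 1)))
      (Or.inl (by simp))
    simpa using h
  refine le_of_tendsto hlim ?_
  filter_upwards [Ioo_mem_nhdsLT (zero_lt_one (α := ℝ))] with c hc
  have hcn : ‖(c : ℂ)‖ = c := by rw [Complex.norm_real, Real.norm_of_nonneg hc.1.le]
  have h := hS ((c : ℂ) • z) (by
    rw [norm_smul, hcn]
    exact (mul_le_of_le_one_right hc.1.le hz).trans_lt hc.2)
  rwa [lintegral_apply_smul, ← ofReal_norm, hcn] at h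

theorem isGelfandIntegrable_of_ball (hg : ∀ z, Measurable fun t => g t z)
    (hS : ∀ z : X, ‖z‖ < 1 → ∫⁻ t, ‖g t z‖ₑ ∂μ ≤ S) (hfin : S < ∞) :
    IsGelfandIntegrable g μ := by
  refine fun z => ⟨hg z, (hg z).aestronglyMeasurable, ?_⟩
  have hc : (0 : ℝ) < ‖z‖ + 1 := by positivity
  have h1 : ‖((‖z‖ + 1 : ℝ) : ℂ)⁻¹ • z‖ < 1 := by
    rw [norm_smul, norm_inv, Complex.norm_real, Real.norm_of_nonneg hc.le, inv_mul_lt_iff₀ hc]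
    linarith
  have h2 := (hS _ h1).trans_lt hfin
  rw [lintegral_apply_smul] at h2
  refine ENNReal.lt_top_of_mul_ne_top_right h2.ne ?_
  rw [Ne, enorm_eq_zero]
  exact inv_ne_zero (by exact_mod_cast hc.ne')

end Gelfand

end GelfandSumming

theorem mainTheorem2
    {Ω : Type*} [MeasurableSpace Ω] (μ : Measure Ω)
    {E F : Type*} [NormedAddCommGroup E] [NormedSpace ℂ E] [CompleteSpace E]
    [NormedAddCommGroup F] [NormedSpace ℂ F] [CompleteSpace F]
    (p p' : ℝ≥0∞) [p.HolderConjugate p'] (hp : p ≠ ∞)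
    (A : Ω → E →L[ℂ] StrongDual ℂ F)
    (hmeas : GelfandSumming.IsWeakStarMeasurable A)
    (hsumming : ∀ᵐ t ∂μ, GelfandSumming.IsSumming p (A t))
    (hsum : ∀ (x : ℕ → E) (y : ℕ → F),
      GelfandSumming.MemWeakEll p x → GelfandSumming.MemEll p' y →
      ∫⁻ t, ∑' n, ‖A t (x n) (y n)‖ₑ ∂μ < ∞) :
    ∃ f : Ω → GelfandSumming.SummingOp E (StrongDual ℂ F) p,
      (∀ᵐ t ∂μ, (f t : E →L[ℂ] StrongDual ℂ F) = A t) ∧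
      GelfandSumming.IsGelfandIntegrable (fun t => (f t).toDual p') μ ∧
      GelfandSumming.gelfandNorm (fun t => (f t).toDual p') μ ≤
        (⨆ (x : ℕ → E) (y : ℕ → F) (_ : GelfandSumming.weakSeqNorm p x ≤ 1)
          (_ : GelfandSumming.seqNorm p' y ≤ 1), ∫⁻ t, ∑' n, ‖A t (x n) (y n)‖ₑ ∂μ) ∧
      (⨆ (x : ℕ → E) (y : ℕ → F) (_ : GelfandSumming.weakSeqNorm p x ≤ 1)
          (_ : GelfandSumming.seqNorm p' y ≤ 1), ∫⁻ t, ∑' n, ‖A t (x n) (y n)‖ₑ ∂μ) < ∞ := by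
  have hp0 := ENNReal.HolderConjugate.ne_zero p p'
  have hfin := GelfandSumming.iSup_lintegral_lt_top hsum
  obtain ⟨N, hN, hNm, hN0⟩ := exists_measurable_superset_of_null (ae_iff.1 hsumming)
  classical
  have hsm : ∀ t, GelfandSumming.IsSumming p (if t ∈ N then 0 else A t) := by
    intro t
    split_ifs with ht
    · exact GelfandSumming.isSumming_zero hp0
    · exact not_not.1 fun h => ht (hN h)
  let f : Ω → GelfandSumming.SummingOp E (StrongDual ℂ F) p := fun t => ⟨_, hsm t⟩
  have hae : ∀ᵐ t ∂μ, (f t : E →L[ℂ] StrongDual ℂ F) = A t := by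
    filter_upwards [measure_eq_zero_iff_ae_notMem.1 hN0] with t ht
    exact if_neg ht
  have hfm : GelfandSumming.IsWeakStarMeasurable fun t => (f t).1 := by
    intro x y
    have : (fun t => (f t).1 x y) = fun t => if t ∈ N then 0 else A t x y := by
      ext t
      by_cases ht : t ∈ N <;> simp [f, ht]
    simp only [this]
    exact Measurable.ite hNm measurable_const (hmeas x y)
  have hball := fun (z : GelfandSumming.CompletedTensorD E F p p') (hz : ‖z‖ < 1) =>
    GelfandSumming.lintegral_toDual_le (μ := μ) hfm (fun w hw => by
      refine le_of_eq_of_le (lintegral_congr_ae ?_)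
        (GelfandSumming.lintegral_tensorFunctional_le (μ := μ) (A := A) hw)
      filter_upwards [hae] with t ht
      rw [ht]) hz
  exact ⟨f, hae, GelfandSumming.isGelfandIntegrable_of_ball
    (fun z => GelfandSumming.measurable_toDual hfm z) hball hfin,
    GelfandSumming.gelfandNorm_le_of_ball hball, hfin⟩
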